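/- Let $\mathcal H,\mathcal F,\mathcal Y$ be real Hilbert spaces, $L:\mathcal H\supset\mathscr D(L)\to\mathcal F$ a closed densely defined linear operator with adjoint $L^*$ and range $R(L^*)$ of the adjoint, $H:\mathcal H\to\mathcal Y$ bounded linear, and let $\mathscr G\subset\mathcal F$ and $\mathscr R\subset\mathscr L(\mathcal Y,\mathcal Y)$ be convex, bounded and closed. A random $\mathcal Y$-valued vector $\eta$ is called admissible if $M(\eta,u)^2<\infty$ and $M(\eta,u)=0$ for all $u\in\mathcal Y$, and it has a correlation operator $R_\eta$, i.e. $M(\eta,u)(\eta,v)=(R_\eta u,v)$ for all $u,v\in\mathcal Y$, that lies in $\mathscr R$. Assume that the problem is feasible: $L\varphi\in\mathscr G$ for some $\varphi\in\mathscr D(L)$, and an admissible $\eta$ exists. Given $\ell\in\mathcal H$, for $u\in\mathcal Y$, $c\in\mathbb R$ put $$\sigma(\ell,u,c)=\sup\bigl\{M\bigl((\ell,\varphi)-(u,H\varphi+\eta)-c\bigr)^2:\ \varphi\in\mathscr D(L),\ L\varphi\in\mathscr G,\ \eta\text{ admissible}\bigr\},\qquad \sigma(\ell,u)=\inf_{c\in\mathbb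 R}\sigma(\ell,u,c),$$ and let $\hat\sigma(\ell)=\bigl(\inf_{u,c}\sigma(\ell,u,c)\bigr)^{1/2}\in[0,\infty]$ be the minimax error. An affine function $y\mapsto(u,y)+c$ is a minimax estimate if $\sigma(\ell,u,c)=\inf_{u',c'}\sigma(\ell,u',c')$. Write $c(\mathscr G,z)=\sup_{f\in\mathscr G}(z,f)$, $(L^*c)(w)=\inf\{c(\mathscr G,z):z\in\mathscr D(L^*),\ L^*z=w\}$ (with $\inf\varnothing=+\infty$), $f^*(x)=\sup_{w}\{(x,w)-f(w)\}$, $\mathrm{cl}f=f^{**}$, $\mathrm{dom}f=\{x:f(x)<\infty\}$, and $s=\mathrm{cl}(L^*c):\mathcal H\to[-\infty,\infty]$. Then: 1. $\hat\sigma(\ell)<\infty$ if and only if there is $u\in\mathcal Y$ with $$\ell-H^*u\in\mathrm{dom}\,s\cap(-1)\,\mathrm{dom}\,s.\qquad(\ast)$$ 2. $R(L^*)\subset\mathrm{dom}\,s\subset\overline{R(L^*)}$. 3. For every $u$ satisfying $(\ast)$, $\sigma(\ell,u)$ is finite and $$\sigma(\ell,u)=\sup_{R_\eta}(R_\eta u,u)+\tfrac14\bigl[s(\ell-H^*u)+s(-\ell+H^*u)\bigr]^2,$$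 where $R_\eta$ ranges over the correlation operators of admissible $\eta$ (so over all of $\mathscr R$ if every element of $\mathscr R$ is the correlation operator of a zero-mean random vector). 4. Suppose $\hat\sigma(\ell)<\infty$. If $\hat u$ is a minimizer of $u\mapsto\sigma(\ell,u)$, then $\hat u$ satisfies $(\ast)$ and $y\mapsto(\hat u,y)+c$ is a minimax estimate exactly for $c=\hat c$, where $$\hat c=\tfrac12\bigl(s(\ell-H^*\hat u)-s(-\ell+H^*\hat u)\bigr).$$ Conversely, if $y\mapsto(u,y)+c$ is a minimax estimate, then $u$ is a minimizer of $u\mapsto\sigma(\ell,u)$. -/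

import Mathlib

open scoped LinearPMap Pointwise ENNReal
open MeasureTheory

noncomputable section

namespace MinimaxEstimation

section Convex

variable {X : Type*} [NormedAddCommGroup X] [InnerProductSpace ℝ X]

/-- The support function `c(G, z) = sup {(z, f) : f ∈ G}`. -/
def supportFunction (G : Set X) (z : X) : EReal :=
  ⨆ f ∈ G, ((inner ℝ z f : ℝ) : EReal)

/-- The Young–Fenchel conjugate `f* (y) = sup_x {(y, x) - f x}`. -/
def conjugate (f : X → EReal) (y : X) : EReal :=
  ⨆ x, (((inner ℝ y x : ℝ) : EReal) - f x)

/-- The closure `cl f = f**` in the sense of Young–Fenchel. -/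
def closureFun (f : X → EReal) : X → EReal :=
  conjugate (conjugate f)

/-- The effective domain `dom f = {x : f x < ∞}`. -/
def effDom (f : X → EReal) : Set X :=
  {x | f x < ⊤}

end Convex

/-- The set of minimum points of a function. -/
def argInf {α : Type*} (f : α → ℝ≥0∞) : Set α :=
  {a | ∀ b, f a ≤ f b}

section Noise

variable {𝓨 : Type*} [NormedAddCommGroup 𝓨] [InnerProductSpace ℝ 𝓨] [MeasurableSpace 𝓨]

/-- `μ` is the law of a random vector `η` in `𝓨` with zero mean and correlation operator `R`, that
is `M (u, η) = 0` and `M (u, η) (v, η) = (R u, v)` for all `u, v`. -/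
structure IsCenteredWithCorrelation (μ : Measure 𝓨) (R : 𝓨 →L[ℝ] 𝓨) : Prop where
  isProbabilityMeasure : IsProbabilityMeasure μ
  memLp : ∀ u : 𝓨, MemLp (fun η => (inner ℝ u η : ℝ)) 2 μ
  mean : ∀ u : 𝓨, ∫ η, (inner ℝ u η : ℝ) ∂μ = 0
  correlation : ∀ u v : 𝓨, ∫ η, (inner ℝ u η : ℝ) * (inner ℝ v η : ℝ) ∂μ = inner ℝ (R u) v

/-- The correlation operators `R_η`, lying in `ℛ`, of the random vectors `η` with zero mean. -/
def admissibleCorrelations (ℛ : Set (𝓨 →L[ℝ] 𝓨)) : Set (𝓨 →L[ℝ] 𝓨) :=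
  {R | R ∈ ℛ ∧ ∃ μ : Measure 𝓨, IsCenteredWithCorrelation μ R}

end Noise

section Problem

variable {𝓗 𝓕 𝓨 : Type*}
  [NormedAddCommGroup 𝓗] [InnerProductSpace ℝ 𝓗]
  [NormedAddCommGroup 𝓕] [InnerProductSpace ℝ 𝓕]
  [NormedAddCommGroup 𝓨] [InnerProductSpace ℝ 𝓨] [MeasurableSpace 𝓨]

/-- `(L* c)(w) = inf {c(G, z) : z ∈ D(L*), L* z = w}`, with value `+∞` when `w ∉ R(L*)`. -/
def adjointImage [CompleteSpace 𝓗] (L : 𝓗 →ₗ.[ℝ] 𝓕) (G : Set 𝓕) (w : 𝓗) : EReal :=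
  ⨅ (z : L†.domain) (_ : L† z = w), supportFunction G (z : 𝓕)

/-- `cl (L* c)`. -/
def clAdjointImage [CompleteSpace 𝓗] (L : 𝓗 →ₗ.[ℝ] 𝓕) (G : Set 𝓕) : 𝓗 → EReal :=
  closureFun (adjointImage L G)

/-- The `u` for which `ℓ - H* u` lies in `dom cl (L* c) ∩ (-1) dom cl (L* c)`. -/
def admissibleSet [CompleteSpace 𝓗] [CompleteSpace 𝓨] (L : 𝓗 →ₗ.[ℝ] 𝓕) (H : 𝓗 →L[ℝ] 𝓨)
    (G : Set 𝓕) (ℓ : 𝓗) : Set 𝓨 :=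
  {u | ℓ - H.adjoint u ∈ effDom (clAdjointImage L G) ∩ -effDom (clAdjointImage L G)}

variable (L : 𝓗 →ₗ.[ℝ] 𝓕) (H : 𝓗 →L[ℝ] 𝓨) (G : Set 𝓕) (ℛ : Set (𝓨 →L[ℝ] 𝓨))

/-- The worst-case mean-squared error of the affine estimate `y ↦ (u, y) + c` of `(ℓ, φ)` from
`y = H φ + η`: the supremum of `M ((ℓ, φ) - (u, y) - c)²` over `φ ∈ D(L)` with `L φ ∈ G` and over
all (laws `μ` of) zero-mean random vectors `η` with correlation operator in `ℛ`. -/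
def worstError (ℓ : 𝓗) (u : 𝓨) (c : ℝ) : ℝ≥0∞ :=
  ⨆ (φ : L.domain) (_ : L φ ∈ G) (μ : Measure 𝓨)
    (_ : ∃ R ∈ ℛ, IsCenteredWithCorrelation μ R),
    ∫⁻ η, ENNReal.ofReal
      (((inner ℝ ℓ (φ : 𝓗) : ℝ) - ((inner ℝ u (H (φ : 𝓗) + η) : ℝ) + c)) ^ 2) ∂μ

/-- `σ(ℓ, u)`: the worst-case mean-squared error for the best constant term. -/
def sigma (ℓ : 𝓗) (u : 𝓨) : ℝ≥0∞ :=
  ⨅ c : ℝ, worstError L H G ℛ ℓ u c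

/-- The minimax mean-squared error `σ̂(ℓ)`, the square root of `inf_{u, c}` of the worst-case
mean-squared error. -/
def minimaxError (ℓ : 𝓗) : ℝ≥0∞ :=
  (⨅ (u : 𝓨) (c : ℝ), worstError L H G ℛ ℓ u c) ^ (1 / 2 : ℝ)

/-- `y ↦ (u, y) + c` is a minimax mean-squared estimate of `(ℓ, φ)`. -/
def IsMinimaxEstimate (ℓ : 𝓗) (u : 𝓨) (c : ℝ) : Prop :=
  worstError L H G ℛ ℓ u c = ⨅ (u' : 𝓨) (c' : ℝ), worstError L H G ℛ ℓ u' c'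

end Problem

end MinimaxEstimation

end

open MinimaxEstimation

/-! Everything rests on one identity: `cl (L* c)` is the support function of the feasible set `{φ ∈
D(L) : L φ ∈ G}`. The conjugate of `L* c` is the indicator of that set: it vanishes at feasible
points since `(L† z, φ) = (z, L φ)`, and it is `+∞` elsewhere by separation from `G`, the density of
`D(L†)` and the biadjoint property of closed operators (`conjugate_adjointImage_of_mem`,
`conjugate_adjointImage_eq_top`).

Put `b = s(ℓ - H* u)` and `a = s(-(ℓ - H* u))`. Over feasible `φ` the values `(ℓ - H* u, φ)` have
infimum `-a` and supremum `b`. Zero mean removes the cross term, so the error splits into a noise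
part and the squared distance from `c` to these values, whose supremum is `((b + a) / 2 + |c - (b -
a) / 2|) ^ 2` (`worstError_eq_ofReal`). The best constant is the midpoint, and it is unique. -/

namespace LinearPMap

/-! ### Closed operators and their adjoints -/

variable {E F : Type*} [NormedAddCommGroup E] [InnerProductSpace ℝ E] [CompleteSpace E]
  [NormedAddCommGroup F] [InnerProductSpace ℝ F] {L : E →ₗ.[ℝ] F}

/-- A pair that satisfies the adjoint relation with every element of the graph of `L†` lies in the
graph of the closed operator `L`. -/
theorem IsClosed.mem_graph_of_inner_adjoint [CompleteSpace F] (hc : L.IsClosed)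
    (hd : Dense (L.domain : Set E)) {x : E} {y : F}
    (h : ∀ z : L†.domain, (inner ℝ (L† z) x : ℝ) = inner ℝ (z : F) y) : (x, y) ∈ L.graph := by
  let e := WithLp.linearEquiv 2 ℝ (E × F)
  -- The graph is moved to the Hilbert-space product, where a closed subspace equals its double
  -- orthogonal complement.
  let K : Submodule ℝ (WithLp 2 (E × F)) := L.graph.comap (e : WithLp 2 (E × F) →ₗ[ℝ] E × F)
  have hK : _root_.IsClosed (K : Set (WithLp 2 (E × F))) :=
    hc.preimage (WithLp.prod_continuous_ofLp 2 E F)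
  have : CompleteSpace K := hK.completeSpace_coe
  suffices WithLp.toLp 2 (x, y) ∈ Kᗮᗮ by
    rw [Submodule.orthogonal_orthogonal] at this
    exact this
  rw [Submodule.mem_orthogonal]
  intro v hv
  rw [Submodule.mem_orthogonal'] at hv
  -- Orthogonality of `v` to the graph says that `v.snd ∈ D(L†)` with `L† v.snd = -v.fst`.
  have hv' : ∀ φ : L.domain, (inner ℝ (-v.fst) (φ : E) : ℝ) = inner ℝ v.snd (L φ) := by
    intro φ
    have := hv (WithLp.toLp 2 ((φ : E), L φ)) (L.mem_graph φ)
    rw [WithLp.prod_inner_apply] at this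
    rw [inner_neg_left]
    exact neg_eq_of_add_eq_zero_right this
  have hm : v.snd ∈ L†.domain := mem_adjoint_domain_of_exists _ ⟨_, hv'⟩
  have ha : L† ⟨v.snd, hm⟩ = -v.fst := adjoint_apply_eq hd ⟨v.snd, hm⟩ hv'
  have := h ⟨v.snd, hm⟩
  rw [ha, inner_neg_left] at this
  rw [WithLp.prod_inner_apply]
  change (inner ℝ v.fst x : ℝ) + inner ℝ v.snd y = 0
  simp only at this
  linarith

/-- The adjoint of a closed densely defined operator is densely defined. -/
theorem IsClosed.dense_adjoint_domain [CompleteSpace F] (hc : L.IsClosed)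
    (hd : Dense (L.domain : Set E)) : Dense (L†.domain : Set F) := by
  rw [Submodule.dense_iff_topologicalClosure_eq_top,
    Submodule.topologicalClosure_eq_top_iff, Submodule.eq_bot_iff]
  intro y hy
  rw [Submodule.mem_orthogonal] at hy
  have := hc.mem_graph_of_inner_adjoint hd (x := 0) (y := y)
    (fun z => by rw [inner_zero_right, hy z z.2])
  exact L.graph_fst_eq_zero_snd this rfl

/-- If `z ↦ (L† z, x)` is bounded by a multiple of the norm, then `x` is in the domain of `L`. -/
theorem IsClosed.mem_domain_of_inner_adjoint_le [CompleteSpace F] (hc : L.IsClosed)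
    (hd : Dense (L.domain : Set E)) {x : E} {C : ℝ}
    (h : ∀ z : L†.domain, (inner ℝ (L† z) x : ℝ) ≤ C * ‖(z : F)‖) : x ∈ L.domain := by
  have hcont : Continuous ((innerₛₗ ℝ x).comp L†.toFun) := by
    refine AddMonoidHomClass.continuous_of_bound _ C fun z => ?_
    have h1 : (inner ℝ (L† z) x : ℝ) ≤ C * ‖z‖ := h z
    have h2 : (inner ℝ (L† (-z)) x : ℝ) ≤ C * ‖-z‖ := h (-z)
    rw [LinearPMap.map_neg, inner_neg_left, norm_neg] at h2
    rw [real_inner_comm] at h1 h2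
    exact abs_le.2 ⟨neg_le.1 h2, h1⟩
  have hx : x ∈ L††.domain := (mem_adjoint_domain_iff _ _).2 hcont
  have hfa := adjoint_isFormalAdjoint (hc.dense_adjoint_domain hd) ⟨x, hx⟩
  exact L.mem_domain_of_mem_graph (hc.mem_graph_of_inner_adjoint hd (y := L†† ⟨x, hx⟩) fun z => by
    rw [real_inner_comm, ← hfa z, real_inner_comm])

/-- A point lies in the preimage under `L` of a closed convex bounded set if it satisfies all the
affine inequalities that come from half-spaces containing the set. -/
theorem IsClosed.exists_apply_mem_of_inner_adjoint_le [CompleteSpace F] (hc : L.IsClosed)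
    (hd : Dense (L.domain : Set E)) {G : Set F} (hconv : Convex ℝ G)
    (hb : Bornology.IsBounded G) (hcl : _root_.IsClosed G) {x : E}
    (h : ∀ (z : L†.domain) (r : ℝ), (∀ g ∈ G, (inner ℝ (z : F) g : ℝ) ≤ r) →
      (inner ℝ (L† z) x : ℝ) ≤ r) : ∃ φ : L.domain, (φ : E) = x ∧ L φ ∈ G := by
  obtain ⟨C, hC⟩ := hb.exists_norm_le
  have hle : ∀ (z : F), ∀ g ∈ G, (inner ℝ z g : ℝ) ≤ C * ‖z‖ := fun z g hg =>
    (real_inner_le_norm z g).trans (by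
      rw [mul_comm]; exact mul_le_mul_of_nonneg_right (hC g hg) (norm_nonneg _))
  have hx : x ∈ L.domain := hc.mem_domain_of_inner_adjoint_le hd fun z => h z _ (hle z)
  refine ⟨⟨x, hx⟩, rfl, ?_⟩
  by_contra hn
  obtain ⟨f, r, hfG, hfx⟩ := geometric_hahn_banach_closed_point hconv hcl hn
  set z := (InnerProductSpace.toDual ℝ F).symm f with hz
  have hf : ∀ y, f y = inner ℝ z y := fun y => by
    rw [hz, InnerProductSpace.toDual_symm_apply]
  set y := L ⟨x, hx⟩
  -- The separating vector `z` need not lie in `D(L†)`. The slack `C * ‖z' - z‖` gives an inequality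
  -- valid on the dense domain and closed in `z'`; at `z' = z` the slack vanishes.
  have hclosed : _root_.IsClosed {z' : F | (inner ℝ z' y : ℝ) ≤ r + C * ‖z' - z‖} :=
    isClosed_le (by fun_prop) (by fun_prop)
  have hsub : (L†.domain : Set F) ⊆ {z' : F | (inner ℝ z' y : ℝ) ≤ r + C * ‖z' - z‖} := by
    intro z' hz'
    have h1 := h ⟨z', hz'⟩ (r + C * ‖z' - z‖) fun g hg => by
      have h2 := hfG g hg
      have h3 := hle (z' - z) g hg
      rw [hf] at h2
      rw [inner_sub_left] at h3
      simp only
      linarith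
    rw [adjoint_isFormalAdjoint hd ⟨z', hz'⟩ ⟨x, hx⟩] at h1
    exact h1
  have hall := (hc.dense_adjoint_domain hd).closure_eq ▸ hclosed.closure_subset_iff.2 hsub
  have := hall (Set.mem_univ z)
  simp only [Set.mem_ofPred_eq, sub_self, norm_zero, mul_zero, add_zero] at this
  rw [hf] at hfx
  linarith

end LinearPMap

namespace MinimaxEstimation

/-! ### The closure of `L* c` and its effective domain -/

section Convex

variable {E F : Type*} [NormedAddCommGroup E] [InnerProductSpace ℝ E] [CompleteSpace E]
  [NormedAddCommGroup F] [InnerProductSpace ℝ F]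
  {L : E →ₗ.[ℝ] F} {G : Set F}

theorem supportFunction_le_coe_iff {z : F} {r : ℝ} :
    supportFunction G z ≤ r ↔ ∀ g ∈ G, (inner ℝ z g : ℝ) ≤ r := by
  simp [supportFunction]

theorem adjointImage_apply_le (z : L†.domain) :
    adjointImage L G (L† z) ≤ supportFunction G (z : F) :=
  iInf₂_le (f := fun (z' : L†.domain) (_ : L† z' = L† z) => supportFunction G (z' : F)) z rfl

theorem conjugate_adjointImage_of_mem (hd : Dense (L.domain : Set E)) {φ : L.domain}
    (hφ : L φ ∈ G) : conjugate (adjointImage L G) (φ : E) = 0 := by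
  apply le_antisymm
  · refine iSup_le fun w => EReal.sub_nonpos.2 (le_iInf₂ fun z hz => ?_)
    rw [← hz, real_inner_comm, LinearPMap.adjoint_isFormalAdjoint hd z φ]
    exact le_iSup₂ (f := fun f (_ : f ∈ G) => ((inner ℝ (z : F) f : ℝ) : EReal)) _ hφ
  · refine le_iSup_of_le 0 ?_
    have h0 : adjointImage L G 0 ≤ ((0 : ℝ) : EReal) := by
      rw [← LinearPMap.map_zero L†]
      refine (adjointImage_apply_le 0).trans (supportFunction_le_coe_iff.2 fun g _ => ?_)
      rw [Submodule.coe_zero, inner_zero_left]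
    rw [inner_zero_right]
    exact (EReal.sub_nonneg (by simp) (by simp)).2 h0

variable [CompleteSpace F]

/-- A finite upper bound `t` on the conjugate would give `(L† z, x) - r ≤ t` whenever `r` bounds
`(z, ·)` on `G`. Replacing `(z, r)` by `(n z, n r)` improves this to `(L† z, x) ≤ r`, which forces
`x` to be feasible. -/
theorem conjugate_adjointImage_eq_top (hc : L.IsClosed) (hd : Dense (L.domain : Set E))
    (hconv : Convex ℝ G) (hb : Bornology.IsBounded G) (hcl : IsClosed G) {x : E}
    (hx : ¬ ∃ φ : L.domain, (φ : E) = x ∧ L φ ∈ G) :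
    conjugate (adjointImage L G) x = ⊤ := by
  by_contra hne
  obtain ⟨t, ht⟩ : ∃ t : ℝ, conjugate (adjointImage L G) x ≤ t :=
    ⟨_, EReal.le_coe_toReal hne⟩
  have key : ∀ (z : L†.domain) (r : ℝ), (∀ g ∈ G, (inner ℝ (z : F) g : ℝ) ≤ r) →
      (inner ℝ (L† z) x : ℝ) - r ≤ t := by
    intro z r hr
    have h1 : adjointImage L G (L† z) ≤ r :=
      (adjointImage_apply_le z).trans (supportFunction_le_coe_iff.2 hr)
    have h2 := ((EReal.sub_le_sub le_rfl h1).trans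
      (le_iSup (fun w => ((inner ℝ x w : ℝ) : EReal) - adjointImage L G w) (L† z))).trans ht
    rw [real_inner_comm]
    exact_mod_cast h2
  refine hx (hc.exists_apply_mem_of_inner_adjoint_le hd hconv hb hcl fun z r hr => ?_)
  by_contra! hlt
  obtain ⟨n, hn⟩ := exists_nat_gt (t / (inner ℝ (L† z) x - r))
  rw [div_lt_iff₀ (sub_pos.2 hlt)] at hn
  have := key ((n : ℝ) • z) (n * r) fun g hg => by
    rw [Submodule.coe_smul, real_inner_smul_left]
    exact mul_le_mul_of_nonneg_left (hr g hg) n.cast_nonneg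
  rw [LinearPMap.map_smul, real_inner_smul_left] at this
  linarith

/-- `cl (L* c)` is the support function of `{φ ∈ D(L) : L φ ∈ G}`. -/
theorem clAdjointImage_eq_iSup (hc : L.IsClosed) (hd : Dense (L.domain : Set E))
    (hconv : Convex ℝ G) (hb : Bornology.IsBounded G) (hcl : IsClosed G) (w : E) :
    clAdjointImage L G w =
      ⨆ (φ : L.domain) (_ : L φ ∈ G), ((inner ℝ w (φ : E) : ℝ) : EReal) := by
  apply le_antisymm
  · refine iSup_le fun x => ?_
    by_cases hx : ∃ φ : L.domain, (φ : E) = x ∧ L φ ∈ G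
    · obtain ⟨φ, rfl, hφ⟩ := hx
      rw [conjugate_adjointImage_of_mem hd hφ, sub_zero]
      exact le_iSup₂ (f := fun (φ : L.domain) (_ : L φ ∈ G) =>
        ((inner ℝ w (φ : E) : ℝ) : EReal)) φ hφ
    · rw [conjugate_adjointImage_eq_top hc hd hconv hb hcl hx, EReal.sub_top]
      exact bot_le
  · refine iSup₂_le fun φ hφ => le_iSup_of_le (φ : E) ?_
    rw [conjugate_adjointImage_of_mem hd hφ, sub_zero]

theorem clAdjointImage_le_coe_iff (hc : L.IsClosed) (hd : Dense (L.domain : Set E))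
    (hconv : Convex ℝ G) (hb : Bornology.IsBounded G) (hcl : IsClosed G) {w : E} {r : ℝ} :
    clAdjointImage L G w ≤ r ↔ ∀ φ : L.domain, L φ ∈ G → (inner ℝ w (φ : E) : ℝ) ≤ r := by
  simp [clAdjointImage_eq_iSup hc hd hconv hb hcl]

theorem mem_effDom_clAdjointImage_iff (hc : L.IsClosed) (hd : Dense (L.domain : Set E))
    (hconv : Convex ℝ G) (hb : Bornology.IsBounded G) (hcl : IsClosed G) {w : E} :
    w ∈ effDom (clAdjointImage L G) ↔
      ∃ r : ℝ, ∀ φ : L.domain, L φ ∈ G → (inner ℝ w (φ : E) : ℝ) ≤ r := by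
  simp_rw [← clAdjointImage_le_coe_iff hc hd hconv hb hcl]
  exact ⟨fun h => ⟨_, EReal.le_coe_toReal h.ne⟩, fun ⟨r, hr⟩ => hr.trans_lt (EReal.coe_lt_top r)⟩

theorem exists_clAdjointImage_eq_coe (hc : L.IsClosed) (hd : Dense (L.domain : Set E))
    (hconv : Convex ℝ G) (hb : Bornology.IsBounded G) (hcl : IsClosed G)
    (hne : ∃ φ : L.domain, L φ ∈ G) {w : E} (hw : w ∈ effDom (clAdjointImage L G)) :
    ∃ r : ℝ, clAdjointImage L G w = r := by
  obtain ⟨φ, hφ⟩ := hne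
  refine ⟨_, (EReal.coe_toReal (ne_of_lt hw) fun h => ?_).symm⟩
  rw [clAdjointImage_eq_iSup hc hd hconv hb hcl, eq_bot_iff] at h
  exact EReal.coe_ne_bot _ (le_bot_iff.1 ((le_iSup₂ (f := fun (φ : L.domain) (_ : L φ ∈ G) =>
        ((inner ℝ w (φ : E) : ℝ) : EReal)) φ hφ).trans h))

theorem range_adjoint_subset_effDom (hc : L.IsClosed) (hd : Dense (L.domain : Set E))
    (hconv : Convex ℝ G) (hb : Bornology.IsBounded G) (hcl : IsClosed G) :
    Set.range (fun z : L†.domain => L† z) ⊆ effDom (clAdjointImage L G) := by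
  rintro _ ⟨z, rfl⟩
  rw [mem_effDom_clAdjointImage_iff hc hd hconv hb hcl]
  obtain ⟨C, hC⟩ := hb.exists_norm_le
  refine ⟨‖(z : F)‖ * C, fun φ hφ => ?_⟩
  rw [LinearPMap.adjoint_isFormalAdjoint hd z φ]
  exact (real_inner_le_norm _ _).trans (mul_le_mul_of_nonneg_left (hC _ hφ) (norm_nonneg _))

/-- A vector orthogonal to `R(L†)` lies in the kernel of `L`, and feasible points may be translated
along the kernel. A functional bounded above on the feasible set must therefore vanish there. -/
theorem effDom_subset_closure_range_adjoint (hc : L.IsClosed) (hd : Dense (L.domain : Set E))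
    (hconv : Convex ℝ G) (hb : Bornology.IsBounded G) (hcl : IsClosed G)
    (hne : ∃ φ : L.domain, L φ ∈ G) :
    effDom (clAdjointImage L G) ⊆ closure (Set.range (fun z : L†.domain => L† z)) := by
  intro w hw
  obtain ⟨r, hr⟩ := (mem_effDom_clAdjointImage_iff hc hd hconv hb hcl).1 hw
  obtain ⟨φ, hφ⟩ := hne
  have hrange : Set.range (fun z : L†.domain => L† z) = (L†.toFun.range : Set E) := rfl
  rw [hrange, ← Submodule.topologicalClosure_coe, ← Submodule.orthogonal_orthogonal_eq_closure,
    SetLike.mem_coe, Submodule.mem_orthogonal]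
  intro n hn
  rw [Submodule.mem_orthogonal] at hn
  have hg : (n, (0 : F)) ∈ L.graph := hc.mem_graph_of_inner_adjoint hd fun z => by
    rw [inner_zero_right]
    exact hn _ ⟨z, rfl⟩
  obtain ⟨ν, hν, hLν⟩ := L.mem_graph_iff.1 hg
  simp only at hν hLν
  subst hν
  have hbound : ∀ t : ℝ, (inner ℝ w (φ : E) : ℝ) + t * inner ℝ w (ν : E) ≤ r := fun t => by
    have := hr (φ + t • ν) (by
      rw [LinearPMap.map_add, LinearPMap.map_smul, hLν, smul_zero, add_zero]; exact hφ)
    rwa [Submodule.coe_add, Submodule.coe_smul, inner_add_right, real_inner_smul_right] at this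
  rw [real_inner_comm]
  by_contra h0
  -- This multiple makes the left side equal to `r + 1`.
  have := hbound ((r + 1 - inner ℝ w (φ : E)) / inner ℝ w (ν : E))
  rw [div_mul_cancel₀ _ h0] at this
  linarith

end Convex

end MinimaxEstimation

namespace MinimaxEstimation

/-! ### Second moments of the noise -/

section Noise

variable {𝓨 : Type*} [NormedAddCommGroup 𝓨] [InnerProductSpace ℝ 𝓨] [MeasurableSpace 𝓨]

theorem IsCenteredWithCorrelation.inner_self_nonneg {μ : Measure 𝓨} {R : 𝓨 →L[ℝ] 𝓨}
    (h : IsCenteredWithCorrelation μ R) (u : 𝓨) : 0 ≤ (inner ℝ (R u) u : ℝ) := by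
  rw [← h.correlation u u]
  exact integral_nonneg fun η => mul_self_nonneg _

/-- The mean square of a constant minus a linear functional of the noise. -/
theorem IsCenteredWithCorrelation.lintegral_sq {μ : Measure 𝓨} {R : 𝓨 →L[ℝ] 𝓨}
    (h : IsCenteredWithCorrelation μ R) (u : 𝓨) (a : ℝ) :
    ∫⁻ η, ENNReal.ofReal ((a - inner ℝ u η) ^ 2) ∂μ =
      ENNReal.ofReal (a ^ 2 + inner ℝ (R u) u) := by
  have := h.isProbabilityMeasure
  have hint : Integrable (fun η => (inner ℝ u η : ℝ)) μ := (h.memLp u).integrable one_le_two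
  have hsq : Integrable (fun η => (inner ℝ u η : ℝ) * inner ℝ u η) μ := by
    simpa only [sq] using (h.memLp u).integrable_sq
  have hexp : (fun η => (a - inner ℝ u η) ^ 2) = fun η =>
      (a ^ 2 - 2 * a * (inner ℝ u η : ℝ)) + (inner ℝ u η : ℝ) * inner ℝ u η := by
    funext η; ring
  have h1 : Integrable (fun η => a ^ 2 - 2 * a * (inner ℝ u η : ℝ)) μ :=
    (integrable_const _).sub (hint.const_mul _)
  rw [← ofReal_integral_eq_lintegral_ofReal (by rw [hexp]; exact h1.add hsq)
    (Filter.Eventually.of_forall fun η => sq_nonneg _), hexp, integral_add h1 hsq,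
    integral_sub (integrable_const _) (hint.const_mul _), integral_const_mul, h.mean u,
    h.correlation u u]
  simp

variable {ℛ : Set (𝓨 →L[ℝ] 𝓨)}

/-- The largest mean square of `(u, η)` over the admissible noises. -/
noncomputable def noiseBound (ℛ : Set (𝓨 →L[ℝ] 𝓨)) (u : 𝓨) : ℝ :=
  sSup ((fun R : 𝓨 →L[ℝ] 𝓨 => (inner ℝ (R u) u : ℝ)) '' admissibleCorrelations ℛ)

theorem bddAbove_noise (hb : Bornology.IsBounded ℛ) (u : 𝓨) :
    BddAbove ((fun R : 𝓨 →L[ℝ] 𝓨 => (inner ℝ (R u) u : ℝ)) '' admissibleCorrelations ℛ) := by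
  obtain ⟨C, hC⟩ := hb.exists_norm_le
  refine ⟨C * ‖u‖ * ‖u‖, ?_⟩
  rintro _ ⟨R, hR, rfl⟩
  refine (real_inner_le_norm _ _).trans (mul_le_mul_of_nonneg_right ?_ (norm_nonneg _))
  exact (R.le_opNorm u).trans (mul_le_mul_of_nonneg_right (hC R hR.1) (norm_nonneg _))

theorem inner_le_noiseBound (hb : Bornology.IsBounded ℛ) (u : 𝓨) {R : 𝓨 →L[ℝ] 𝓨}
    (hR : R ∈ admissibleCorrelations ℛ) : (inner ℝ (R u) u : ℝ) ≤ noiseBound ℛ u :=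
  le_csSup (bddAbove_noise hb u) ⟨R, hR, rfl⟩

theorem noiseBound_nonneg (hb : Bornology.IsBounded ℛ) (hne : (admissibleCorrelations ℛ).Nonempty)
    (u : 𝓨) : 0 ≤ noiseBound ℛ u := by
  obtain ⟨R, hR⟩ := hne
  obtain ⟨μ, hμ⟩ := hR.2
  exact (hμ.inner_self_nonneg u).trans (inner_le_noiseBound hb u hR)

theorem coe_noiseBound (hb : Bornology.IsBounded ℛ) (hne : (admissibleCorrelations ℛ).Nonempty)
    (u : 𝓨) : ((noiseBound ℛ u : ℝ) : EReal) =
      ⨆ R ∈ admissibleCorrelations ℛ, ((inner ℝ (R u) u : ℝ) : EReal) := by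
  apply le_antisymm
  · set S : EReal := ⨆ R ∈ admissibleCorrelations ℛ, ((inner ℝ (R u) u : ℝ) : EReal)
    have hle : ∀ R ∈ admissibleCorrelations ℛ, ((inner ℝ (R u) u : ℝ) : EReal) ≤ S :=
      fun R hR => le_iSup₂ (f := fun (R : 𝓨 →L[ℝ] 𝓨) (_ : R ∈ admissibleCorrelations ℛ) =>
        ((inner ℝ (R u) u : ℝ) : EReal)) R hR
    clear_value S
    induction S with
    | bot =>
      obtain ⟨R, hR⟩ := hne
      exact absurd (le_bot_iff.1 (hle R hR)) (EReal.coe_ne_bot _)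
    | top => exact le_top
    | coe r =>
      refine EReal.coe_le_coe_iff.2 (csSup_le (hne.image _) ?_)
      rintro _ ⟨R, hR, rfl⟩
      exact EReal.coe_le_coe_iff.1 (hle R hR)
  · exact iSup₂_le fun R hR => EReal.coe_le_coe_iff.2 (inner_le_noiseBound hb u hR)

end Noise

/-! ### The worst-case error of an affine estimate -/

section Problem

variable {𝓗 𝓕 𝓨 : Type*}
  [NormedAddCommGroup 𝓗] [InnerProductSpace ℝ 𝓗]
  [NormedAddCommGroup 𝓕] [InnerProductSpace ℝ 𝓕]
  [NormedAddCommGroup 𝓨] [InnerProductSpace ℝ 𝓨] [MeasurableSpace 𝓨]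
  {L : 𝓗 →ₗ.[ℝ] 𝓕} {H : 𝓗 →L[ℝ] 𝓨} {G : Set 𝓕} {ℛ : Set (𝓨 →L[ℝ] 𝓨)} {ℓ : 𝓗} {u : 𝓨} {c : ℝ}

theorem minimaxError_lt_top_iff :
    minimaxError L H G ℛ ℓ < ⊤ ↔ ∃ u, sigma L H G ℛ ℓ u < ⊤ := by
  rw [minimaxError, ENNReal.rpow_lt_top_iff_of_pos (by norm_num), iInf_lt_iff]
  rfl

variable [CompleteSpace 𝓗] [CompleteSpace 𝓨]

/-- The law of the noise enters only through its correlation operator, since the mean square depends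
on nothing else. -/
theorem worstError_le_ofReal_iff {K : ℝ} (hK : 0 ≤ K) :
    worstError L H G ℛ ℓ u c ≤ ENNReal.ofReal K ↔
      ∀ φ : L.domain, L φ ∈ G → ∀ R ∈ admissibleCorrelations ℛ,
        ((inner ℝ (ℓ - H.adjoint u) (φ : 𝓗) : ℝ) - c) ^ 2 + inner ℝ (R u) u ≤ K := by
  have hval : ∀ (φ : L.domain) (μ : Measure 𝓨) (R : 𝓨 →L[ℝ] 𝓨), IsCenteredWithCorrelation μ R →
      ∫⁻ η, ENNReal.ofReal
        (((inner ℝ ℓ (φ : 𝓗) : ℝ) - ((inner ℝ u (H (φ : 𝓗) + η) : ℝ) + c)) ^ 2) ∂μ =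
      ENNReal.ofReal
        (((inner ℝ (ℓ - H.adjoint u) (φ : 𝓗) : ℝ) - c) ^ 2 + inner ℝ (R u) u) := by
    intro φ μ R hR
    rw [← hR.lintegral_sq]
    congr 1 with η
    rw [inner_sub_left, ContinuousLinearMap.adjoint_inner_left, inner_add_right]
    ring_nf
  simp only [worstError, iSup_le_iff]
  constructor
  · rintro h φ hφ R ⟨hR, μ, hμ⟩
    have := h φ hφ μ ⟨R, hR, hμ⟩
    rwa [hval φ μ R hμ, ENNReal.ofReal_le_ofReal_iff hK] at this
  · rintro h φ hφ μ ⟨R, hR, hμ⟩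
    rw [hval φ μ R hμ]
    exact ENNReal.ofReal_le_ofReal (h φ hφ R ⟨hR, μ, hμ⟩)

/-- A finite worst-case error bounds the deviation of `(ℓ - H* u, φ)` from the constant term. -/
theorem abs_sub_le_of_worstError_le
    (hne : (admissibleCorrelations ℛ).Nonempty) (hG : ∃ φ : L.domain, L φ ∈ G) {K : ℝ}
    (hK : 0 ≤ K) (h : worstError L H G ℛ ℓ u c ≤ ENNReal.ofReal K) :
    noiseBound ℛ u ≤ K ∧ ∀ φ : L.domain, L φ ∈ G →
      |(inner ℝ (ℓ - H.adjoint u) (φ : 𝓗) : ℝ) - c| ≤ √(K - noiseBound ℛ u) := by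
  rw [worstError_le_ofReal_iff hK] at h
  have key : ∀ φ : L.domain, L φ ∈ G →
      noiseBound ℛ u ≤ K - ((inner ℝ (ℓ - H.adjoint u) (φ : 𝓗) : ℝ) - c) ^ 2 := by
    intro φ hφ
    refine csSup_le (hne.image _) ?_
    rintro _ ⟨R, hR, rfl⟩
    have := h φ hφ R hR
    simp only
    linarith
  refine ⟨?_, fun φ hφ => Real.abs_le_sqrt (by linarith [key φ hφ])⟩
  obtain ⟨φ, hφ⟩ := hG
  exact (key φ hφ).trans (sub_le_self _ (sq_nonneg _))

variable [CompleteSpace 𝓕]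

/-- The worst-case error, when `s (ℓ - H* u) = b` and `s (-(ℓ - H* u)) = a` are finite. -/
theorem worstError_eq_ofReal (hc : L.IsClosed) (hd : Dense (L.domain : Set 𝓗))
    (hconv : Convex ℝ G) (hGb : Bornology.IsBounded G) (hcl : IsClosed G)
    (hG : ∃ φ : L.domain, L φ ∈ G) (hb : Bornology.IsBounded ℛ)
    (hne : (admissibleCorrelations ℛ).Nonempty) {a b : ℝ}
    (hbs : clAdjointImage L G (ℓ - H.adjoint u) = b)
    (has : clAdjointImage L G (-(ℓ - H.adjoint u)) = a) (c : ℝ) :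
    0 ≤ (b + a) / 2 ∧ worstError L H G ℛ ℓ u c =
      ENNReal.ofReal (noiseBound ℛ u + ((b + a) / 2 + |c - (b - a) / 2|) ^ 2) := by
  have hb' := (clAdjointImage_le_coe_iff hc hd hconv hGb hcl).1 hbs.le
  have ha' := (clAdjointImage_le_coe_iff hc hd hconv hGb hcl).1 has.le
  simp only [inner_neg_left] at ha'
  have hab : 0 ≤ (b + a) / 2 := by
    obtain ⟨φ, hφ⟩ := hG
    linarith [hb' φ hφ, ha' φ hφ]
  refine ⟨hab, ?_⟩
  have hρ := noiseBound_nonneg hb hne u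
  have hF : 0 ≤ noiseBound ℛ u + ((b + a) / 2 + |c - (b - a) / 2|) ^ 2 := by positivity
  have hle : worstError L H G ℛ ℓ u c ≤
      ENNReal.ofReal (noiseBound ℛ u + ((b + a) / 2 + |c - (b - a) / 2|) ^ 2) := by
    rw [worstError_le_ofReal_iff hF]
    intro φ hφ R hR
    rw [add_comm]
    refine add_le_add (inner_le_noiseBound hb u hR) (sq_le_sq' ?_ ?_)
    · linarith [ha' φ hφ, le_abs_self (c - (b - a) / 2)]
    · linarith [hb' φ hφ, neg_abs_le (c - (b - a) / 2)]
  refine le_antisymm hle ?_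
  have htop : worstError L H G ℛ ℓ u c ≠ ⊤ := (hle.trans_lt ENNReal.ofReal_lt_top).ne
  obtain ⟨hK, hdev⟩ := abs_sub_le_of_worstError_le hne hG ENNReal.toReal_nonneg
    (ENNReal.ofReal_toReal htop).ge
  rw [ENNReal.ofReal_le_iff_le_toReal htop]
  set K := (worstError L H G ℛ ℓ u c).toReal
  set q := √(K - noiseBound ℛ u) with hq
  -- All values lie within `q` of `c`, so their bounds `b` and `-a` do too; the larger of `b - c`
  -- and `a + c` is the half-width plus the distance from `c` to the midpoint.
  have h1 : b ≤ c + q := EReal.coe_le_coe_iff.1 (hbs ▸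
    (clAdjointImage_le_coe_iff hc hd hconv hGb hcl).2 fun φ hφ => by
      linarith [(abs_le.1 (hdev φ hφ)).2])
  have h2 : a ≤ q - c := EReal.coe_le_coe_iff.1 (has ▸
    (clAdjointImage_le_coe_iff hc hd hconv hGb hcl).2 fun φ hφ => by
      rw [inner_neg_left]
      linarith [(abs_le.1 (hdev φ hφ)).1])
  have h3 : (b + a) / 2 + |c - (b - a) / 2| ≤ q := by
    rcases abs_cases (c - (b - a) / 2) with h | h <;> linarith
  have h4 := pow_le_pow_left₀ (by positivity) h3 2
  rw [hq, Real.sq_sqrt (sub_nonneg.2 hK)] at h4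
  linarith

theorem mem_admissibleSet_of_worstError_lt_top (hc : L.IsClosed) (hd : Dense (L.domain : Set 𝓗))
    (hconv : Convex ℝ G) (hGb : Bornology.IsBounded G) (hcl : IsClosed G)
    (hG : ∃ φ : L.domain, L φ ∈ G)
    (hne : (admissibleCorrelations ℛ).Nonempty) (h : worstError L H G ℛ ℓ u c < ⊤) :
    u ∈ admissibleSet L H G ℓ := by
  obtain ⟨-, hdev⟩ := abs_sub_le_of_worstError_le hne hG ENNReal.toReal_nonneg
    (ENNReal.ofReal_toReal h.ne).ge
  change _ ∈ effDom _ ∧ -(ℓ - H.adjoint u) ∈ effDom _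
  rw [mem_effDom_clAdjointImage_iff hc hd hconv hGb hcl,
    mem_effDom_clAdjointImage_iff hc hd hconv hGb hcl]
  refine ⟨⟨_, fun φ hφ => sub_le_iff_le_add.1 (abs_le.1 (hdev φ hφ)).2⟩,
    ⟨√((worstError L H G ℛ ℓ u c).toReal - noiseBound ℛ u) - c, fun φ hφ => ?_⟩⟩
  rw [inner_neg_left]
  linarith [(abs_le.1 (hdev φ hφ)).1]

theorem mem_admissibleSet_of_sigma_lt_top (hc : L.IsClosed) (hd : Dense (L.domain : Set 𝓗))
    (hconv : Convex ℝ G) (hGb : Bornology.IsBounded G) (hcl : IsClosed G)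
    (hG : ∃ φ : L.domain, L φ ∈ G)
    (hne : (admissibleCorrelations ℛ).Nonempty) (h : sigma L H G ℛ ℓ u < ⊤) :
    u ∈ admissibleSet L H G ℓ := by
  obtain ⟨c, hc'⟩ := iInf_lt_iff.1 h
  exact mem_admissibleSet_of_worstError_lt_top hc hd hconv hGb hcl hG hne hc'

theorem sigma_eq_ofReal (hc : L.IsClosed) (hd : Dense (L.domain : Set 𝓗))
    (hconv : Convex ℝ G) (hGb : Bornology.IsBounded G) (hcl : IsClosed G)
    (hG : ∃ φ : L.domain, L φ ∈ G) (hb : Bornology.IsBounded ℛ)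
    (hne : (admissibleCorrelations ℛ).Nonempty) {a b : ℝ}
    (hbs : clAdjointImage L G (ℓ - H.adjoint u) = b)
    (has : clAdjointImage L G (-(ℓ - H.adjoint u)) = a) :
    sigma L H G ℛ ℓ u = ENNReal.ofReal (noiseBound ℛ u + ((b + a) / 2) ^ 2) := by
  have hw := worstError_eq_ofReal hc hd hconv hGb hcl hG hb hne hbs has
  apply le_antisymm
  · refine (iInf_le _ ((b - a) / 2)).trans ?_
    rw [(hw _).2, sub_self, abs_zero, add_zero]
  · refine le_iInf fun c => ?_
    rw [(hw c).2]
    refine ENNReal.ofReal_le_ofReal (add_le_add_right (pow_le_pow_left₀ (hw c).1 ?_ 2) _)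
    exact le_add_of_nonneg_right (abs_nonneg _)

theorem worstError_eq_sigma_iff (hc : L.IsClosed) (hd : Dense (L.domain : Set 𝓗))
    (hconv : Convex ℝ G) (hGb : Bornology.IsBounded G) (hcl : IsClosed G)
    (hG : ∃ φ : L.domain, L φ ∈ G) (hb : Bornology.IsBounded ℛ)
    (hne : (admissibleCorrelations ℛ).Nonempty) {a b : ℝ}
    (hbs : clAdjointImage L G (ℓ - H.adjoint u) = b)
    (has : clAdjointImage L G (-(ℓ - H.adjoint u)) = a) :
    worstError L H G ℛ ℓ u c = sigma L H G ℛ ℓ u ↔ c = (b - a) / 2 := by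
  obtain ⟨hab, hw⟩ := worstError_eq_ofReal hc hd hconv hGb hcl hG hb hne hbs has c
  have hρ := noiseBound_nonneg hb hne u
  rw [hw, sigma_eq_ofReal hc hd hconv hGb hcl hG hb hne hbs has,
    ENNReal.ofReal_eq_ofReal_iff (by positivity) (by positivity), add_right_inj,
    pow_left_inj₀ (by positivity) hab two_ne_zero, add_eq_left, abs_eq_zero, sub_eq_zero]

theorem sigma_lt_top_of_mem_admissibleSet (hc : L.IsClosed) (hd : Dense (L.domain : Set 𝓗))
    (hconv : Convex ℝ G) (hGb : Bornology.IsBounded G) (hcl : IsClosed G)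
    (hG : ∃ φ : L.domain, L φ ∈ G) (hb : Bornology.IsBounded ℛ)
    (hne : (admissibleCorrelations ℛ).Nonempty) (h : u ∈ admissibleSet L H G ℓ) :
    sigma L H G ℛ ℓ u < ⊤ := by
  obtain ⟨b, hbs⟩ := exists_clAdjointImage_eq_coe hc hd hconv hGb hcl hG h.1
  obtain ⟨a, has⟩ := exists_clAdjointImage_eq_coe hc hd hconv hGb hcl hG h.2
  rw [sigma_eq_ofReal hc hd hconv hGb hcl hG hb hne hbs has]
  exact ENNReal.ofReal_lt_top

end Problem

end MinimaxEstimation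

open MinimaxEstimation
theorem mainTheorem4 {𝓗 𝓕 𝓨 : Type*}
    [NormedAddCommGroup 𝓗] [InnerProductSpace ℝ 𝓗] [CompleteSpace 𝓗]
    [NormedAddCommGroup 𝓕] [InnerProductSpace ℝ 𝓕] [CompleteSpace 𝓕]
    [NormedAddCommGroup 𝓨] [InnerProductSpace ℝ 𝓨] [CompleteSpace 𝓨]
    [MeasurableSpace 𝓨] [BorelSpace 𝓨]
    (L : 𝓗 →ₗ.[ℝ] 𝓕) (hL_closed : L.IsClosed) (hL_dense : Dense (L.domain : Set 𝓗))
    (H : 𝓗 →L[ℝ] 𝓨)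
    (G : Set 𝓕) (hG_convex : Convex ℝ G) (hG_bounded : Bornology.IsBounded G)
    (hG_closed : IsClosed G) (hG_feasible : ∃ φ : L.domain, L φ ∈ G)
    (ℛ : Set (𝓨 →L[ℝ] 𝓨)) (hR_convex : Convex ℝ ℛ) (hR_bounded : Bornology.IsBounded ℛ)
    (hR_closed : IsClosed ℛ)
    (hR_feasible : (admissibleCorrelations ℛ).Nonempty)
    (ℓ : 𝓗) :
    -- finiteness of the minimax error
    (minimaxError L H G ℛ ℓ < ⊤ ↔ (admissibleSet L H G ℓ).Nonempty) ∧
    -- location of the domain of `cl (L* c)`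
    (Set.range (fun z : L†.domain => L† z) ⊆ effDom (clAdjointImage L G) ∧
      effDom (clAdjointImage L G) ⊆ closure (Set.range (fun z : L†.domain => L† z))) ∧
    -- the error formula
    (∀ u ∈ admissibleSet L H G ℓ, sigma L H G ℛ ℓ u < ⊤ ∧
      ((sigma L H G ℛ ℓ u : ℝ≥0∞) : EReal) =
        (⨆ R ∈ admissibleCorrelations ℛ, ((inner ℝ (R u) u : ℝ) : EReal)) +
          ((1 / 4 : ℝ) : EReal) *
            (clAdjointImage L G (ℓ - H.adjoint u) +
              clAdjointImage L G (-ℓ + H.adjoint u)) ^ 2) ∧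
    -- the minimax estimates
    (minimaxError L H G ℛ ℓ < ⊤ →
      (∀ u_hat ∈ argInf (sigma L H G ℛ ℓ), u_hat ∈ admissibleSet L H G ℓ ∧
        ∃ c_hat : ℝ,
          (c_hat : EReal) = ((1 / 2 : ℝ) : EReal) *
            (clAdjointImage L G (ℓ - H.adjoint u_hat) -
              clAdjointImage L G (-ℓ + H.adjoint u_hat)) ∧
          ∀ c : ℝ, IsMinimaxEstimate L H G ℛ ℓ u_hat c ↔ c = c_hat) ∧
      (∀ (u : 𝓨) (c : ℝ), IsMinimaxEstimate L H G ℛ ℓ u c →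
        u ∈ argInf (sigma L H G ℛ ℓ))) := by
  have hwin : ∀ u ∈ admissibleSet L H G ℓ, ∃ a b : ℝ,
      clAdjointImage L G (ℓ - H.adjoint u) = b ∧
      clAdjointImage L G (-(ℓ - H.adjoint u)) = a := fun u hu => by
    obtain ⟨b, hb⟩ := exists_clAdjointImage_eq_coe hL_closed hL_dense hG_convex hG_bounded
      hG_closed hG_feasible hu.1
    obtain ⟨a, ha⟩ := exists_clAdjointImage_eq_coe hL_closed hL_dense hG_convex hG_bounded
      hG_closed hG_feasible hu.2
    exact ⟨a, b, hb, ha⟩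
  have hneg : ∀ u, -ℓ + H.adjoint u = -(ℓ - H.adjoint u) := fun u => by abel
  -- The inner infimum over `c'` is `sigma` by definition, so minimizing `sigma` means attaining the
  -- joint infimum.
  have hinf : ∀ u, u ∈ argInf (sigma L H G ℛ ℓ) ↔
      sigma L H G ℛ ℓ u = ⨅ (u' : 𝓨) (c' : ℝ), worstError L H G ℛ ℓ u' c' := fun u =>
    ⟨fun h => le_antisymm (le_iInf h) (iInf_le (sigma L H G ℛ ℓ) u),
      fun h u' => h.trans_le (iInf_le (sigma L H G ℛ ℓ) u')⟩
  refine ⟨?_, ⟨?_, ?_⟩, ?_, ?_⟩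
  · rw [minimaxError_lt_top_iff]
    exact exists_congr fun u =>
      ⟨mem_admissibleSet_of_sigma_lt_top hL_closed hL_dense hG_convex hG_bounded hG_closed
        hG_feasible hR_feasible,
      sigma_lt_top_of_mem_admissibleSet hL_closed hL_dense hG_convex hG_bounded hG_closed
        hG_feasible hR_bounded hR_feasible⟩
  · exact range_adjoint_subset_effDom hL_closed hL_dense hG_convex hG_bounded hG_closed
  · exact effDom_subset_closure_range_adjoint hL_closed hL_dense hG_convex hG_bounded hG_closed
      hG_feasible
  · intro u hu
    refine ⟨sigma_lt_top_of_mem_admissibleSet hL_closed hL_dense hG_convex hG_bounded hG_closed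
        hG_feasible hR_bounded hR_feasible hu, ?_⟩
    obtain ⟨a, b, hb, ha⟩ := hwin u hu
    have hρ := noiseBound_nonneg hR_bounded hR_feasible u
    rw [hneg, hb, ha, ← coe_noiseBound hR_bounded hR_feasible,
      sigma_eq_ofReal hL_closed hL_dense hG_convex hG_bounded hG_closed
        hG_feasible hR_bounded hR_feasible hb ha, EReal.coe_ennreal_ofReal,
      max_eq_left (by positivity)]
    norm_cast
    ring
  · intro hfin
    refine ⟨fun u hu => ?_, fun u c h => ?_⟩
    · obtain ⟨u', hu'⟩ := minimaxError_lt_top_iff.1 hfin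
      have hmem := mem_admissibleSet_of_sigma_lt_top hL_closed hL_dense hG_convex hG_bounded
        hG_closed hG_feasible hR_feasible ((hu u').trans_lt hu')
      obtain ⟨a, b, hb, ha⟩ := hwin u hmem
      refine ⟨hmem, (b - a) / 2, ?_, fun c => ?_⟩
      · rw [hneg, hb, ha]
        norm_cast
        ring
      · rw [IsMinimaxEstimate, ← (hinf u).1 hu]
        exact worstError_eq_sigma_iff hL_closed hL_dense hG_convex hG_bounded hG_closed
          hG_feasible hR_bounded hR_feasible hb ha
    · refine (hinf u).2 (le_antisymm ((iInf_le _ c).trans h.le) ?_)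
      exact iInf_le (sigma L H G ℛ ℓ) u
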